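/- Let $M=4$ and let $\mathbf X\sim N(\boldsymbol\mu,\Sigma)$ with $\boldsymbol\mu\in\mathbb R^4$ unknown and $\Sigma$ the known intraclass matrix with diagonal entries $1$ and off-diagonal entries $\rho$, $0<\rho<1$. Consider testing $H_i:\mu_i=0$ against $K_i:\mu_i\neq0$, $i=1,\dots,4$. For a set $A$ of indices write $\mathbf x_A$, $\Sigma_A$ for the corresponding subvector and principal submatrix, and let $\mathbf g$ be the first column of $\Sigma$. The likelihood ratio step-down method (LRSD) with critical values $C_1>C_2>C_3>C_4>0$ starts with $A=\{1,2,3,4\}$. At stage $m$ it performs, from $\mathbf x_A$, the likelihood ratio test of $\boldsymbol\mu_A=\mathbf 0$ against $\boldsymbol\mu_A\ne\mathbf 0$, rejecting iff $2\log\big(\sup_{\boldsymbol\mu_A} f(\mathbf x_A|\boldsymbol\mu_A)/f(\mathbf x_A|\mathbf 0)\big)\ge C_m$, where $f(\cdot|\boldsymbol\mu_A)$ is the $N(\boldsymbol\mu_A,\Sigma_A)$ density. If this test accepts, stop and accept all remaining $H_i$, $i\in A$. Otherwise reject $H_j$, where $j\in A$ maximizes $|x_j|$ (the smallest such index in case of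 ties), remove $j$ from $A$, and go to stage $m+1$ (stop after stage 4). A test of $H_1$ is a measurable $\varphi:\mathbb R^4\to[0,1]$ (the probability of rejection). Its risk at $\boldsymbol\mu$ is $E_{\boldsymbol\mu}\varphi$ if $\mu_1=0$ and $1-E_{\boldsymbol\mu}\varphi$ if $\mu_1\ne0$. It is inadmissible if another test has risk that is nowhere larger and somewhere smaller. Let $b>a+\Delta>a>0$, $\epsilon>0$, $0<\rho<1$, $\gamma=\epsilon/\rho$ and $\mathbf x^*=(a,-a-\Delta,b,-b-\epsilon)'$. Then: 1. For every non-empty $A$ and every $\mathbf x$, the likelihood ratio statistic of $\mathbf x_A$ equals $\mathbf x_A'\Sigma_A^{-1}\mathbf x_A$. 2. With $A=\{1,2,3\}$, $$\mathbf x^{*\prime}_A\Sigma_A^{-1}\mathbf x^*_A=\frac{(1+\rho)b^2+2a^2(1+2\rho)+2\Delta[a+2a\rho+\rho b+(1+\rho)\Delta/2]}{1+\rho-2\rho^2}.$$ 3. With $A=\{1,2,3\}$ and $B=\{1,2,4\}$, the difference $\mathbf x^{*\prime}_A\Sigma_A^{-1}\mathbf x^*_A-(\mathbf x^*+\gamma\mathbf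 g)_B'\Sigma_B^{-1}(\mathbf x^*+\gamma\mathbf g)_B$ equals $$D=\frac{4\Delta b\rho-\epsilon^2\left[\rho-1+\frac1\rho+\frac1{\rho^2}\right]-\epsilon\left[\frac{2a}\rho+2a-4a\rho-2\rho\Delta+2(1+\rho)b\right]}{1+\rho-2\rho^2}.$$ 4. Suppose $D>0$. Then there are $C_1>C_2>C_3>C_4>0$ such that $C_1<\mathbf x^{*\prime}\Sigma^{-1}\mathbf x^*$, $C_2=\mathbf x^{*\prime}_A\Sigma_A^{-1}\mathbf x^*_A$ for $A=\{1,2,3\}$, $C_3\le\mathbf x^{*\prime}_A\Sigma_A^{-1}\mathbf x^*_A$ for $A=\{1,2\}$, and $C_4\le\mathbf x^{*\prime}_A\Sigma_A^{-1}\mathbf x^*_A=a^2$ for $A=\{1\}$. For all such critical values: - at $\mathbf x^*$, LRSD rejects every $H_i$, in particular $H_1$; - $(\mathbf x^*+\gamma\mathbf g)'\Sigma^{-1}(\mathbf x^*+\gamma\mathbf g)>C_1$, and at $\mathbf x^*+\gamma\mathbf g$ LRSD rejects $H_3$ and accepts $H_1,H_2,H_4$; - at $\mathbf x^*-x_1^*\mathbf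 g$, LRSD accepts $H_1$; - writing $\mathbf y=\Sigma^{-1}\mathbf x$, the acceptance section in $y_1$ of the LRSD test of $H_1$, with $(y_2,y_3,y_4)$ fixed at their values at $\mathbf x^*$, is not an interval; - the test of $H_1$ induced by LRSD is a (measurable) test and is inadmissible for $H_1$ against $K_1$. 5. For $a=2$, $b=4$, $\Delta=1$, $\epsilon=0.1$, $\rho=0.5$ (so that $\gamma=0.2$) one has $D>0$, so 4 applies. -/

import Mathlib

open MeasureTheory ProbabilityTheory
open scoped Matrix

noncomputable section

/-- The intraclass covariance matrix: unit variances, all covariances equal to `ρ`. -/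
def intraclass (M : ℕ) (ρ : ℝ) : Matrix (Fin M) (Fin M) ℝ :=
  Matrix.of fun i j => if i = j then 1 else ρ

/-- The density at `x` of the normal law with mean `μ` and (positive definite) covariance `S`. -/
def normalDensity {ι : Type} [Fintype ι] [DecidableEq ι] (S : Matrix ι ι ℝ) (μ x : ι → ℝ) : ℝ :=
  Real.exp (-(1 / 2) * ((x - μ) ⬝ᵥ (S⁻¹ *ᵥ (x - μ)))) /
    ((2 * Real.pi) ^ ((Fintype.card ι : ℝ) / 2) * √S.det)

/-- The likelihood ratio statistic of `μ = 0` against unrestricted `μ`,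
on the scale `2 log (sup_μ f(x | μ) / f(x | 0))`. -/
def likelihoodRatioStat {ι : Type} [Fintype ι] [DecidableEq ι] (S : Matrix ι ι ℝ) (x : ι → ℝ) : ℝ :=
  2 * Real.log ((⨆ μ : ι → ℝ, normalDensity S μ x) / normalDensity S 0 x)

/-- The covariance matrix of the subvector with coordinates in `A`. -/
def subCov {M : ℕ} (S : Matrix (Fin M) (Fin M) ℝ) (A : Finset (Fin M)) : Matrix A A ℝ :=
  S.submatrix Subtype.val Subtype.val

/-- The subvector with coordinates in `A`. -/
def subVec {M : ℕ} (x : EuclideanSpace ℝ (Fin M)) (A : Finset (Fin M)) : A → ℝ :=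
  fun i => x i

/-- The quadratic form `x_A' Σ_A⁻¹ x_A` of the subvector with coordinates in `A`. -/
def subQuad {M : ℕ} (S : Matrix (Fin M) (Fin M) ℝ) (A : Finset (Fin M))
    (x : EuclideanSpace ℝ (Fin M)) : ℝ :=
  subVec x A ⬝ᵥ ((subCov S A)⁻¹ *ᵥ subVec x A)

/-- `i` is the index in `A` with the largest `|x i|` (the smallest such index if there is a tie). -/
def IsLargest {M : ℕ} (x : EuclideanSpace ℝ (Fin M)) (A : Finset (Fin M)) (i : Fin M) : Prop :=
  i ∈ A ∧ ∀ j ∈ A, |x j| ≤ |x i| ∧ (|x j| = |x i| → i ≤ j)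

open Classical in
/-- The indices that are left after `m` variables have been eliminated, at each stage the one
with the largest absolute value. -/
def remaining {M : ℕ} (x : EuclideanSpace ℝ (Fin M)) : ℕ → Finset (Fin M)
  | 0 => Finset.univ
  | m + 1 => (remaining x m).filter fun i => ¬ IsLargest x (remaining x m) i

/-- The likelihood ratio step-down procedure with critical values `C 0, …, C (M - 1)` (counted
from `0`) rejects `H_i` at `x`: for some stage `m`, the global likelihood ratio tests of the stages
`0, …, m` all reject, and `i` is the index that is eliminated at stage `m`. -/
def LRSDRejects {M : ℕ} (S : Matrix (Fin M) (Fin M) ℝ) (C : Fin M → ℝ)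
    (x : EuclideanSpace ℝ (Fin M)) (i : Fin M) : Prop :=
  ∃ m : Fin M, IsLargest x (remaining x m) i ∧
    ∀ k ≤ m, C k ≤ likelihoodRatioStat (subCov S (remaining x k)) (subVec x (remaining x k))

open Classical in
/-- The test function of `H_i` that is induced by the step-down procedure
(`1` for rejection, `0` for acceptance). -/
def lrsdTest {M : ℕ} (S : Matrix (Fin M) (Fin M) ℝ) (C : Fin M → ℝ) (i : Fin M)
    (x : EuclideanSpace ℝ (Fin M)) : ℝ :=
  if LRSDRejects S C x i then 1 else 0

/-- A (possibly randomized) test: a measurable probability of rejection. -/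
def IsTest {M : ℕ} (φ : EuclideanSpace ℝ (Fin M) → ℝ) : Prop :=
  Measurable φ ∧ ∀ x, 0 ≤ φ x ∧ φ x ≤ 1

/-- The expectation of `φ(X)` for `X ~ N(μ, S)`. -/
def rejectProb {M : ℕ} (S : Matrix (Fin M) (Fin M) ℝ) (φ : EuclideanSpace ℝ (Fin M) → ℝ)
    (μ : EuclideanSpace ℝ (Fin M)) : ℝ :=
  ∫ x, φ x ∂(multivariateGaussian μ S)

open Classical in
/-- The testing risk of `φ` for `H_i : μ_i = 0` against `K_i : μ_i ≠ 0`, at the mean vector `μ`: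
the probability of a wrong decision. -/
def testRisk {M : ℕ} (S : Matrix (Fin M) (Fin M) ℝ) (i : Fin M)
    (φ : EuclideanSpace ℝ (Fin M) → ℝ) (μ : EuclideanSpace ℝ (Fin M)) : ℝ :=
  if μ i = 0 then rejectProb S φ μ else 1 - rejectProb S φ μ

/-- A test is admissible for `H_i` against `K_i` if no test has a risk that is nowhere larger and
somewhere smaller. -/
def Admissible {M : ℕ} (S : Matrix (Fin M) (Fin M) ℝ) (i : Fin M)
    (φ : EuclideanSpace ℝ (Fin M) → ℝ) : Prop :=
  IsTest φ ∧ ¬ ∃ ψ : EuclideanSpace ℝ (Fin M) → ℝ, IsTest ψ ∧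
    (∀ μ, testRisk S i ψ μ ≤ testRisk S i φ μ) ∧ ∃ μ, testRisk S i ψ μ < testRisk S i φ μ

/-- The acceptance section in `y_i` of a test `φ`, where `y = S⁻¹ x`: the values `t` such that `φ`
accepts at the sample point `x` for which `S⁻¹ x` is `y` with its `i`-th coordinate replaced
by `t`. -/
def acceptSection {M : ℕ} (S : Matrix (Fin M) (Fin M) ℝ) (i : Fin M)
    (φ : EuclideanSpace ℝ (Fin M) → ℝ) (y : Fin M → ℝ) : Set ℝ :=
  {t | φ (WithLp.toLp 2 (S *ᵥ Function.update y i t)) = 0}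

/-- The first column of the intraclass matrix of size `4`. -/
def gVec (ρ : ℝ) : EuclideanSpace ℝ (Fin 4) :=
  WithLp.toLp 2 fun i => intraclass 4 ρ i 0

/-- The sample point `x* = (a, -a - Δ, b, -b - ε)'`. -/
def xStar (a b Δ ε : ℝ) : EuclideanSpace ℝ (Fin 4) :=
  !₂[a, -a - Δ, b, -b - ε]

/-- The closed form of the second-stage statistic at `x*`. -/
def stageTwoStat (a b Δ ρ : ℝ) : ℝ :=
  1 / (1 + ρ - 2 * ρ ^ 2) *
    ((1 + ρ) * b ^ 2 + 2 * a ^ 2 * (1 + 2 * ρ)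
      + 2 * Δ * (a + 2 * a * ρ + ρ * b + (1 + ρ) * Δ / 2))

/-- The closed form of the second-stage statistic at `x*` minus the one at `x* + (ε / ρ) g`. -/
def stageTwoGap (a b Δ ε ρ : ℝ) : ℝ :=
  1 / (1 + ρ - 2 * ρ ^ 2) *
    (4 * Δ * b * ρ - ε ^ 2 * (ρ - 1 + 1 / ρ + 1 / ρ ^ 2)
      - ε * (2 * a / ρ + 2 * a - 4 * a * ρ - 2 * ρ * Δ + 2 * (1 + ρ) * b))

/-- The choice of critical values `C_1 > C_2 > C_3 > C_4 > 0` (indexed from `0`): `C_1` is less than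
the first-stage statistic at `x*`, `C_2` equals the second-stage statistic at `x*`, and `C_3`, `C_4`
do not exceed the statistics of the subvectors `(x*_1, x*_2)` and `(x*_1)`. -/
def CriticalChoice (a b Δ ε ρ : ℝ) (C : Fin 4 → ℝ) : Prop :=
  C 1 < C 0 ∧ C 2 < C 1 ∧ C 3 < C 2 ∧ 0 < C 3 ∧
    C 0 < subQuad (intraclass 4 ρ) Finset.univ (xStar a b Δ ε) ∧
    C 1 = subQuad (intraclass 4 ρ) {0, 1, 2} (xStar a b Δ ε) ∧
    C 2 ≤ subQuad (intraclass 4 ρ) {0, 1} (xStar a b Δ ε) ∧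
    C 3 ≤ subQuad (intraclass 4 ρ) {0} (xStar a b Δ ε)

end

/-! A section of the acceptance region with a rejected gap is exhibited, and such a gap forces
inadmissibility.

The gap. Write `x*` for `xStar` and γ for `ε / ρ`. Since `Σ⁻¹ g` is the first unit vector, moving
`y_1` alone moves `x` along `g`. The step from `x*` to `x* + γ g` adds `ε` to the last three
coordinates, which turns `(b, -b - ε)` into `(b + ε, -b)`. The third variable is therefore
eliminated first instead of the fourth, and the second stage sees `{0, 1, 3}` instead of `{0, 1,
2}`. Its statistic there is `C 1 - D`, so the procedure stops and the first hypothesis is accepted,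
although it is rejected at `x*`. At `x* - a g` the fourth variable is again eliminated first, and
the second-stage statistic is `C 1 - a ^ 2`, so the first hypothesis is accepted there too. The
order claimed at `x* + γ g` needs `a + γ < b + ε`, which follows from `D > 0`
(`add_div_lt_of_stageTwoGap_pos`).

Inadmissibility. The coordinate `X_i` is independent of the residual `X - X_i g`, and the lines in
direction `g` are the fibres of the residual. On a small box around such a fibre, rejection
probability is moved from the rejected middle to the two accepted outer pieces. The change in power
factors into a one-dimensional normal quantity and the probability of a residual event. By convexity
of `exp`, the moved masses can be chosen so that the first factor is zero at `μ i = 0` and positive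
at every other mean (`exists_power_increasing_perturbation`, `not_admissible_of_gap`). This needs
open pieces, whereas `x*` satisfies the second-stage inequality only with equality. The argument is
therefore run at `c • x*` with `c > 1` close to 1. -/

/-! ### One-dimensional normal family: raising the power of a two-sided test -/

/-- The affine function through two points of `u ↦ exp (m * u)` lies strictly above it between the
points and strictly below it elsewhere. -/
theorem exists_affine_separating_exp {m c₁ c₂ : ℝ} (hm : m ≠ 0) (hc : c₁ < c₂) :
    ∃ A B : ℝ, (∀ u < c₁, A + B * u < Real.exp (m * u)) ∧
      (∀ u, c₁ < u → u < c₂ → Real.exp (m * u) < A + B * u) ∧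
      ∀ u, c₂ < u → A + B * u < Real.exp (m * u) := by
  have hconv : StrictConvexOn ℝ Set.univ fun u : ℝ => Real.exp (m * u) := by
    refine ⟨convex_univ, fun x _ y _ hxy a b ha hb hab => ?_⟩
    have hne : m * x ≠ m * y := fun h => hxy (mul_left_cancel₀ hm h)
    have := strictConvexOn_exp.2 (Set.mem_univ (m * x)) (Set.mem_univ (m * y)) hne ha hb hab
    simp only [smul_eq_mul] at this ⊢
    convert this using 2
    ring
  set f : ℝ → ℝ := fun u => Real.exp (m * u) with hf
  have hd : 0 < c₂ - c₁ := sub_pos.2 hc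
  set B := (f c₂ - f c₁) / (c₂ - c₁) with hB
  have hB' : B * (c₂ - c₁) = f c₂ - f c₁ := div_mul_cancel₀ _ hd.ne'
  refine ⟨f c₁ - B * c₁, B, fun u hu => ?_, fun u hu hu' => ?_, fun u hu => ?_⟩
  · have := hconv.slope_strict_mono_adjacent (Set.mem_univ u) (Set.mem_univ c₂) hu hc
    rw [← hB, div_lt_iff₀ (sub_pos.2 hu)] at this
    change _ < f u
    linarith
  · have := hconv.secant_strict_mono (Set.mem_univ c₁) (Set.mem_univ u) (Set.mem_univ c₂)
      hu.ne' hc.ne' hu'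
    rw [← hB, div_lt_iff₀ (sub_pos.2 hu)] at this
    change f u < _
    linarith
  · have := hconv.slope_strict_mono_adjacent (Set.mem_univ c₁) (Set.mem_univ u) hc hu
    rw [← hB, lt_div_iff₀ (sub_pos.2 hu)] at this
    change _ < f u
    linarith

theorem setIntegral_ball_lt_of_lt {ν : Measure ℝ} {c r : ℝ} (hν : 0 < ν (Metric.ball c r))
    {f g : ℝ → ℝ} (hf : IntegrableOn f (Metric.ball c r) ν)
    (hg : IntegrableOn g (Metric.ball c r) ν) (hfg : ∀ u ∈ Metric.ball c r, f u < g u) :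
    ∫ u in Metric.ball c r, f u ∂ν < ∫ u in Metric.ball c r, g u ∂ν := by
  rw [← sub_pos, ← integral_sub' hg hf,
    setIntegral_pos_iff_support_of_nonneg_ae _ (hg.sub hf)]
  · refine hν.trans_le (measure_mono fun u hu => ⟨?_, hu⟩)
    exact (sub_pos.2 (hfg u hu)).ne'
  · filter_upwards [ae_restrict_mem Metric.isOpen_ball.measurableSet] with u hu
    exact (sub_pos.2 (hfg u hu)).le

theorem Continuous.integrableOn_ball_of_isFiniteMeasure {ν : Measure ℝ} [IsFiniteMeasure ν]
    {f : ℝ → ℝ} (hf : Continuous f) (c r : ℝ) : IntegrableOn f (Metric.ball c r) ν :=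
  (hf.continuousOn.integrableOn_compact (isCompact_closedBall c r)).mono_set
    Metric.ball_subset_closedBall

theorem gaussianReal_ball_pos (m c : ℝ) {r : ℝ} (hr : 0 < r) :
    0 < gaussianReal m 1 (Metric.ball c r) := by
  rw [gaussianReal_apply_eq_integral _ one_ne_zero, ENNReal.ofReal_pos,
    setIntegral_pos_iff_support_of_nonneg_ae
      (Filter.Eventually.of_forall fun x => gaussianPDFReal_nonneg _ _ x)
      (integrable_gaussianPDFReal _ _).integrableOn]
  refine (Metric.measure_ball_pos volume c hr).trans_le (measure_mono fun u hu => ⟨?_, hu⟩)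
  exact (gaussianPDFReal_pos m 1 u one_ne_zero).ne'

/-- The measures with mean `m` form an exponential family. -/
theorem gaussianReal_real_eq_setIntegral_exp (m : ℝ) {s : Set ℝ} (hs : MeasurableSet s) :
    (gaussianReal m 1).real s
      = Real.exp (-(m ^ 2 / 2)) * ∫ u in s, Real.exp (m * u) ∂(gaussianReal 0 1) := by
  rw [measureReal_def, gaussianReal_apply_eq_integral _ one_ne_zero,
    ENNReal.toReal_ofReal (integral_nonneg fun x => gaussianPDFReal_nonneg _ _ x),
    ← integral_const_mul, ← integral_indicator hs, ← integral_indicator hs,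
    integral_gaussianReal_eq_integral_smul one_ne_zero]
  congr 1 with u
  by_cases hu : u ∈ s
  · simp only [Set.indicator_of_mem hu, smul_eq_mul, gaussianPDFReal]
    rw [← Real.exp_add, mul_assoc (_)⁻¹, ← Real.exp_add]
    congr 2
    push_cast
    ring
  · simp [Set.indicator_of_notMem hu]

/-- Moving rejection probability from a middle interval to two outer ones can be done so that the
size of a two-sided test does not change and its power increases at every alternative. -/
theorem exists_power_increasing_perturbation {u₁ u₂ u₃ r : ℝ} (hr : 0 < r)
    (h₁₂ : u₁ + r < u₂ - r) (h₂₃ : u₂ + r < u₃ - r) :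
    ∃ α β γ : ℝ, (0 ≤ α ∧ α ≤ 1) ∧ (0 ≤ β ∧ β ≤ 1) ∧ (0 ≤ γ ∧ γ ≤ 1) ∧
      (α * (gaussianReal 0 1).real (Metric.ball u₁ r)
        - β * (gaussianReal 0 1).real (Metric.ball u₂ r)
        + γ * (gaussianReal 0 1).real (Metric.ball u₃ r) = 0) ∧
      ∀ m ≠ 0, 0 < α * (gaussianReal m 1).real (Metric.ball u₁ r)
        - β * (gaussianReal m 1).real (Metric.ball u₂ r)
        + γ * (gaussianReal m 1).real (Metric.ball u₃ r) := by
  obtain ⟨c₁, hc₁, hc₁'⟩ := exists_between h₁₂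
  obtain ⟨c₂, hc₂, hc₂'⟩ := exists_between h₂₃
  have hc : c₁ < c₂ := by linarith
  set ν := gaussianReal 0 1 with hν
  have hI : ∀ c u, u ∈ Metric.ball c r → c - r < u ∧ u < c + r := fun c u hu => by
    rw [Real.ball_eq_Ioo] at hu; exact hu
  have hint : ∀ {f : ℝ → ℝ} (c : ℝ), Continuous f → IntegrableOn f (Metric.ball c r) ν :=
    fun c hf => hf.integrableOn_ball_of_isFiniteMeasure c r
  have hpos := fun c => gaussianReal_ball_pos 0 c hr
  set p : ℝ → ℝ := fun c => ν.real (Metric.ball c r) with hp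
  set q : ℝ → ℝ := fun c => ∫ u in Metric.ball c r, u ∂ν with hq
  have hp0 : ∀ c, 0 < p c := fun c => ENNReal.toReal_pos (hpos c).ne' (measure_ne_top _ _)
  have haff : ∀ c A B, ∫ u in Metric.ball c r, (A + B * u) ∂ν = A * p c + B * q c := by
    intro c A B
    rw [integral_add (hint c continuous_const) (hint c (by fun_prop)), integral_const_mul]
    simp [hp, hq, mul_comm]
  -- The barycentres `q / p` of the three balls are separated by `c₁` and `c₂`; this gives the signs
  -- of `α`, `β`, `γ` below.
  have hq₁ : q u₁ < c₁ * p u₁ := by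
    have := setIntegral_ball_lt_of_lt (hpos u₁) (hint u₁ continuous_id)
      (hint u₁ (continuous_const (y := c₁))) fun u hu => by
        have := hI _ _ hu; simp only [id]; linarith
    simpa [hp, hq, mul_comm] using this
  have hq₂ : c₁ * p u₂ < q u₂ := by
    have := setIntegral_ball_lt_of_lt (hpos u₂) (hint u₂ (continuous_const (y := c₁)))
      (hint u₂ continuous_id) fun u hu => by
        have := hI _ _ hu; simp only [id]; linarith
    simpa [hp, hq, mul_comm] using this
  have hq₂' : q u₂ < c₂ * p u₂ := by
    have := setIntegral_ball_lt_of_lt (hpos u₂) (hint u₂ continuous_id)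
      (hint u₂ (continuous_const (y := c₂))) fun u hu => by
        have := hI _ _ hu; simp only [id]; linarith
    simpa [hp, hq, mul_comm] using this
  have hq₃ : c₂ * p u₃ < q u₃ := by
    have := setIntegral_ball_lt_of_lt (hpos u₃) (hint u₃ (continuous_const (y := c₂)))
      (hint u₃ continuous_id) fun u hu => by
        have := hI _ _ hu; simp only [id]; linarith
    simpa [hp, hq, mul_comm] using this
  -- The vector `(α, -β, γ)` is the cross product of the mass vector `p` and the first-moment vector
  -- `q`. It is orthogonal to both, so the signed combination annihilates every affine function.
  -- Dividing by the sum brings the weights into `[0, 1]`.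
  set α := p u₂ * q u₃ - p u₃ * q u₂ with hα
  set β := p u₁ * q u₃ - p u₃ * q u₁ with hβ
  set γ := p u₁ * q u₂ - p u₂ * q u₁ with hγ
  have hα0 : 0 < α := by
    have h1 := mul_lt_mul_of_pos_left hq₃ (hp0 u₂)
    have h2 := mul_lt_mul_of_pos_left hq₂' (hp0 u₃)
    rw [hα]; linarith
  have hγ0 : 0 < γ := by
    have h1 := mul_lt_mul_of_pos_left hq₂ (hp0 u₁)
    have h2 := mul_lt_mul_of_pos_left hq₁ (hp0 u₂)
    rw [hγ]; linarith
  have hβ0 : 0 < β := by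
    have h1 := mul_lt_mul_of_pos_left hq₃ (hp0 u₁)
    have h2 := mul_lt_mul_of_pos_left hq₁ (hp0 u₃)
    have h3 := mul_lt_mul_of_pos_left hc (mul_pos (hp0 u₁) (hp0 u₃))
    rw [hβ]; linarith
  have hs : 0 < α + β + γ := by positivity
  have hzero : α * p u₁ - β * p u₂ + γ * p u₃ = 0 := by rw [hα, hβ, hγ]; ring
  have hzero' : α * q u₁ - β * q u₂ + γ * q u₃ = 0 := by rw [hα, hβ, hγ]; ring
  refine ⟨α / (α + β + γ), β / (α + β + γ), γ / (α + β + γ),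
    ⟨by positivity, (div_le_one hs).2 (by linarith)⟩,
    ⟨by positivity, (div_le_one hs).2 (by linarith)⟩,
    ⟨by positivity, (div_le_one hs).2 (by linarith)⟩, ?_, fun m hm => ?_⟩
  · calc _ = (α * p u₁ - β * p u₂ + γ * p u₃) / (α + β + γ) := by simp only [hp]; ring
      _ = 0 := by rw [hzero, zero_div]
  · obtain ⟨A, B, hA₁, hA₂, hA₃⟩ := exists_affine_separating_exp hm hc
    set E : ℝ → ℝ := fun c => ∫ u in Metric.ball c r, Real.exp (m * u) ∂ν with hE
    have hE₁ : A * p u₁ + B * q u₁ < E u₁ := by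
      rw [← haff]
      exact setIntegral_ball_lt_of_lt (hpos u₁) (hint u₁ (by fun_prop)) (hint u₁ (by fun_prop))
        fun u hu => hA₁ u (by linarith [hI _ _ hu])
    have hE₂ : E u₂ < A * p u₂ + B * q u₂ := by
      rw [← haff]
      exact setIntegral_ball_lt_of_lt (hpos u₂) (hint u₂ (by fun_prop)) (hint u₂ (by fun_prop))
        fun u hu => hA₂ u (by linarith [hI _ _ hu]) (by linarith [hI _ _ hu])
    have hE₃ : A * p u₃ + B * q u₃ < E u₃ := by
      rw [← haff]
      exact setIntegral_ball_lt_of_lt (hpos u₃) (hint u₃ (by fun_prop)) (hint u₃ (by fun_prop))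
        fun u hu => hA₃ u (by linarith [hI _ _ hu])
    -- The affine function contributes zero, and `exp (m * u)` exceeds it on the outer balls and is
    -- below it on the middle one, so every weighted difference is positive.
    have hmain : 0 < α * E u₁ - β * E u₂ + γ * E u₃ := by
      have h1 := mul_lt_mul_of_pos_left hE₁ hα0
      have h2 := mul_lt_mul_of_pos_left hE₂ hβ0
      have h3 := mul_lt_mul_of_pos_left hE₃ hγ0
      have h4 : A * (α * p u₁ - β * p u₂ + γ * p u₃)
        + B * (α * q u₁ - β * q u₂ + γ * q u₃) = 0 := by rw [hzero, hzero']; ring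
      linarith
    simp only [gaussianReal_real_eq_setIntegral_exp m Metric.isOpen_ball.measurableSet]
    calc (0 : ℝ) < Real.exp (-(m ^ 2 / 2)) * (α * E u₁ - β * E u₂ + γ * E u₃) / (α + β + γ) := by
          positivity
      _ = _ := by simp only [hE]; ring

/-! ### Regression residuals and inadmissibility from a gap -/

/-- Under a multivariate normal law a coordinate of unit variance is independent of the residuals of
the regressions on it. -/
theorem indepFun_eval_residual {M : ℕ} {S : Matrix (Fin M) (Fin M) ℝ} {i : Fin M}
    (hS : S.PosSemidef) (hii : S i i = 1) (μ : EuclideanSpace ℝ (Fin M)) :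
    IndepFun (fun x : EuclideanSpace ℝ (Fin M) => x i) (fun x j => x j - x i * S i j)
      (multivariateGaussian μ S) := by
  have hL : ∀ j, MemLp (fun x : EuclideanSpace ℝ (Fin M) => x j) 2 (multivariateGaussian μ S) :=
    fun j => (HasGaussianLaw.map_fun (IsGaussian.hasGaussianLaw_id
      (μ := multivariateGaussian μ S)) (EuclideanSpace.proj (𝕜 := ℝ) j)).memLp_two
  have hG : HasGaussianLaw (fun x : EuclideanSpace ℝ (Fin M) =>
      ((fun _ : Unit => x i), fun j => x j - x i * S i j)) (multivariateGaussian μ S) :=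
    HasGaussianLaw.map_fun (IsGaussian.hasGaussianLaw_id (μ := multivariateGaussian μ S))
      ((ContinuousLinearMap.pi fun _ : Unit => EuclideanSpace.proj (𝕜 := ℝ) i).prod
        (ContinuousLinearMap.pi fun j => EuclideanSpace.proj (𝕜 := ℝ) j
          - (ContinuousLinearMap.toSpanSingleton ℝ (S i j)).comp
            (EuclideanSpace.proj (𝕜 := ℝ) i)))
  -- Under joint normality it suffices that the covariance `S i j - S i i * S i j` vanishes. The
  -- single coordinate is indexed by `Unit` because the criterion is about families.
  have hind := HasGaussianLaw.indepFun_of_covariance_eval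
    (X := fun (_ : Unit) (x : EuclideanSpace ℝ (Fin M)) => x i)
    (Y := fun j (x : EuclideanSpace ℝ (Fin M)) => x j - x i * S i j) hG fun _ j => by
      rw [covariance_fun_sub_right (hL i) (hL j) ((hL i).mul_const _),
        covariance_mul_const_right, covariance_eval_multivariateGaussian hS,
        covariance_eval_multivariateGaussian hS, hii, one_mul, sub_self]
  exact hind.comp (φ := fun f : Unit → ℝ => f ()) (ψ := id) (measurable_pi_apply ()) measurable_id

theorem multivariateGaussian_eq_map_add {M : ℕ} (S : Matrix (Fin M) (Fin M) ℝ)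
    (μ : EuclideanSpace ℝ (Fin M)) :
    multivariateGaussian μ S = (multivariateGaussian 0 S).map fun x => μ + x := by
  simp only [multivariateGaussian]
  rw [Measure.map_map (by fun_prop) (by fun_prop)]
  congr 1 with x
  simp

theorem rejectProb_add_indicators {M : ℕ} {S : Matrix (Fin M) (Fin M) ℝ}
    {φ : EuclideanSpace ℝ (Fin M) → ℝ} (hφ : IsTest φ) {A₁ A₂ A₃ : Set (EuclideanSpace ℝ (Fin M))}
    (h₁ : MeasurableSet A₁) (h₂ : MeasurableSet A₂) (h₃ : MeasurableSet A₃) (α β γ : ℝ)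
    (μ : EuclideanSpace ℝ (Fin M)) :
    rejectProb S (fun x => φ x + (A₁.indicator (fun _ => α) x - A₂.indicator (fun _ => β) x
        + A₃.indicator (fun _ => γ) x)) μ
      = rejectProb S φ μ + (α * (multivariateGaussian μ S).real A₁
        - β * (multivariateGaussian μ S).real A₂ + γ * (multivariateGaussian μ S).real A₃) := by
  have hi : ∀ {A : Set (EuclideanSpace ℝ (Fin M))} (c : ℝ), MeasurableSet A →
      Integrable (A.indicator fun _ => c) (multivariateGaussian μ S) :=
    fun c hA => (integrable_const c).indicator hA
  have hφi : Integrable φ (multivariateGaussian μ S) :=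
    Integrable.of_bound hφ.1.aestronglyMeasurable 1 (Filter.Eventually.of_forall fun x => by
      rw [Real.norm_eq_abs, abs_le]; constructor <;> linarith [(hφ.2 x).1, (hφ.2 x).2])
  unfold rejectProb
  change ∫ x, (φ + (A₁.indicator (fun _ => α) - A₂.indicator (fun _ => β)
    + A₃.indicator fun _ => γ)) x ∂_ = _
  rw [integral_add' hφi (((hi α h₁).sub (hi β h₂)).add (hi γ h₃)),
    integral_add' ((hi α h₁).sub (hi β h₂)) (hi γ h₃), integral_sub' (hi α h₁) (hi β h₂),
    integral_indicator_const _ h₁, integral_indicator_const _ h₂, integral_indicator_const _ h₃]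
  simp only [smul_eq_mul, mul_comm]

/-- A test whose acceptance region has, in the direction of the regression on the `i`-th coordinate,
an open gap between two open pieces is inadmissible for `H_i : μ i = 0` against `μ i ≠ 0`. -/
theorem not_admissible_of_gap {M : ℕ} {S : Matrix (Fin M) (Fin M) ℝ} {i : Fin M}
    (hS : S.PosSemidef) (hii : S i i = 1) {φ : EuclideanSpace ℝ (Fin M) → ℝ}
    {p : EuclideanSpace ℝ (Fin M)} {s t : ℝ} (hs : 0 < s) (ht : 0 < t)
    (h₁ : ∀ᶠ x in nhds (p - s • WithLp.toLp 2 (S i)), φ x = 0)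
    (h₂ : ∀ᶠ x in nhds p, φ x = 1)
    (h₃ : ∀ᶠ x in nhds (p + t • WithLp.toLp 2 (S i)), φ x = 0) :
    ¬ Admissible S i φ := by
  rintro ⟨hφ, hno⟩
  apply hno
  set z : EuclideanSpace ℝ (Fin M) → (Fin M → ℝ) := fun x j => x j - x i * S i j with hz
  have hzc : Continuous z := by fun_prop
  have hzline : ∀ c : ℝ, z (p + c • WithLp.toLp 2 (S i)) = z p := by
    intro c
    ext j
    simp [hz, hii]
    ring
  have hbox : ∀ (c : ℝ) (P : EuclideanSpace ℝ (Fin M) → Prop),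
      (∀ᶠ x in nhds (p + c • WithLp.toLp 2 (S i)), P x) →
      ∃ r > 0, ∀ x, z x ∈ Metric.ball (z p) r → x i ∈ Metric.ball (p i + c) r → P x := by
    intro c P hP
    -- `F` recovers `x` from its residual and its `i`-th coordinate, so a neighbourhood of a point
    -- on the line contains a product box in these two independent statistics.
    let F : (Fin M → ℝ) × ℝ → EuclideanSpace ℝ (Fin M) := fun w =>
      WithLp.toLp 2 fun j => w.1 j + w.2 * S i j
    have hF : Continuous F := by fun_prop
    have hF0 : F (z p, p i + c) = p + c • WithLp.toLp 2 (S i) := by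
      ext j
      simp [F, hz]
      ring
    have hFx : ∀ x, F (z x, x i) = x := by
      intro x
      ext j
      simp [F, hz]
    have := hF.tendsto (z p, p i + c)
    rw [hF0] at this
    obtain ⟨r, hr, hb⟩ := Metric.eventually_nhds_iff_ball.1 (this.eventually hP)
    refine ⟨r, hr, fun x hx hx' => ?_⟩
    have := hb (z x, x i) (by rw [← ball_prod_same]; exact ⟨hx, hx'⟩)
    rwa [hFx] at this
  obtain ⟨r₁, hr₁, hb₁⟩ := hbox (-s) (fun x => φ x = 0) (by simpa [sub_eq_add_neg] using h₁)
  obtain ⟨r₂, hr₂, hb₂⟩ := hbox 0 (fun x => φ x = 1) (by simpa using h₂)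
  obtain ⟨r₃, hr₃, hb₃⟩ := hbox t (fun x => φ x = 0) h₃
  obtain ⟨r, hr, hrlt⟩ : ∃ r > 0, r ≤ r₁ ∧ r ≤ r₂ ∧ r ≤ r₃ ∧ r < s / 2 ∧ r < t / 2 := by
    have hm : 0 < min (min r₁ (min r₂ r₃)) (min (s / 2) (t / 2)) := by positivity
    obtain ⟨r, hr, hr'⟩ := exists_between hm
    simp only [lt_min_iff] at hr'
    exact ⟨r, hr, hr'.1.1.le, hr'.1.2.1.le, hr'.1.2.2.le, hr'.2.1, hr'.2.2⟩
  obtain ⟨hrr₁, hrr₂, hrr₃, hrs, hrt⟩ := hrlt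
  obtain ⟨α, β, γ, hα, hβ, hγ, hsize, hpower⟩ :=
    exists_power_increasing_perturbation (u₁ := p i + -s) (u₂ := p i + 0) (u₃ := p i + t) hr
      (by linarith) (by linarith)
  set U := Metric.ball (z p) r with hU
  let A : ℝ → Set (EuclideanSpace ℝ (Fin M)) :=
    fun c => (fun x => x i) ⁻¹' Metric.ball (p i + c) r ∩ z ⁻¹' U
  have hAm : ∀ c, MeasurableSet (A c) := fun c =>
    ((Metric.isOpen_ball.preimage (by fun_prop)).inter
      (Metric.isOpen_ball.preimage hzc)).measurableSet
  have hA : ∀ μ c, (multivariateGaussian μ S).real (A c)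
      = (gaussianReal (μ i) 1).real (Metric.ball (p i + c) r)
        * (multivariateGaussian μ S).real (z ⁻¹' U) := by
    intro μ c
    have h := (indepFun_eval_residual hS hii μ).measure_inter_preimage_eq_mul
      (Metric.ball (p i + c) r) U Metric.isOpen_ball.measurableSet Metric.isOpen_ball.measurableSet
    have hm := (measurePreserving_eval_multivariateGaussian (μ := μ) hS (i := i)).measure_preimage
      (s := Metric.ball (p i + c) r) Metric.isOpen_ball.measurableSet.nullMeasurableSet
    rw [hii, Real.toNNReal_one] at hm
    rw [hm] at h
    simp only [measureReal_def, A, ← ENNReal.toReal_mul]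
    exact congrArg ENNReal.toReal h
  set ψ : EuclideanSpace ℝ (Fin M) → ℝ := fun x => φ x + ((A (-s)).indicator (fun _ => α) x
    - (A 0).indicator (fun _ => β) x + (A t).indicator (fun _ => γ) x) with hψ
  have hψprob : ∀ μ, rejectProb S ψ μ = rejectProb S φ μ
      + (α * (gaussianReal (μ i) 1).real (Metric.ball (p i + -s) r)
        - β * (gaussianReal (μ i) 1).real (Metric.ball (p i + 0) r)
        + γ * (gaussianReal (μ i) 1).real (Metric.ball (p i + t) r))
        * (multivariateGaussian μ S).real (z ⁻¹' U) := by
    intro μ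
    rw [hψ, rejectProb_add_indicators hφ (hAm _) (hAm _) (hAm _)]
    simp only [hA]
    ring
  have hdisj : ∀ {c d : ℝ} {x : EuclideanSpace ℝ (Fin M)}, c + 2 * r < d → x ∈ A c → x ∉ A d := by
    rintro c d x hcd ⟨hx, -⟩ ⟨hx', -⟩
    simp only [Set.mem_preimage, Real.ball_eq_Ioo, Set.mem_Ioo] at hx hx'
    linarith [hx.2, hx'.1]
  have hball : ∀ {r' c : ℝ} {x : EuclideanSpace ℝ (Fin M)}, r ≤ r' → x ∈ A c →
      z x ∈ Metric.ball (z p) r' ∧ x i ∈ Metric.ball (p i + c) r' :=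
    fun h hx => ⟨Metric.ball_subset_ball h hx.2, Metric.ball_subset_ball h hx.1⟩
  have hψtest : IsTest ψ := by
    refine ⟨hφ.1.add (((measurable_const.indicator (hAm _)).sub
      (measurable_const.indicator (hAm _))).add (measurable_const.indicator (hAm _))),
      fun x => ?_⟩
    simp only [hψ]
    by_cases hx₁ : x ∈ A (-s)
    · have hx₂ : x ∉ A 0 := hdisj (by linarith) hx₁
      have hx₃ : x ∉ A t := hdisj (by linarith) hx₁
      rw [hb₁ x (hball hrr₁ hx₁).1 (hball hrr₁ hx₁).2]
      simpa [hx₁, hx₂, hx₃] using hα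
    by_cases hx₂ : x ∈ A 0
    · have hx₃ : x ∉ A t := hdisj (by linarith) hx₂
      rw [hb₂ x (hball hrr₂ hx₂).1 (hball hrr₂ hx₂).2]
      simpa [hx₁, hx₂, hx₃, and_comm] using hβ
    by_cases hx₃ : x ∈ A t
    · rw [hb₃ x (hball hrr₃ hx₃).1 (hball hrr₃ hx₃).2]
      simpa [hx₁, hx₂, hx₃] using hγ
    · simpa [hx₁, hx₂, hx₃] using hφ.2 x
  refine ⟨ψ, hψtest, fun μ => ?_, ?_⟩
  · unfold testRisk
    split_ifs with hμ
    · rw [hψprob, hμ, hsize, zero_mul, add_zero]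
    · rw [hψprob]
      have := mul_nonneg (hpower (μ i) hμ).le
        (measureReal_nonneg (μ := multivariateGaussian μ S) (s := z ⁻¹' U))
      linarith
  -- `S` may be singular, so an open set can be null. Here `c` is a point of the support of the
  -- centred law, and `μ` is chosen so that `μ + c` has the residual of `p` while `μ i = 1` is an
  -- alternative.
  · obtain ⟨c, -, hc⟩ := exists_mem_forall_mem_nhdsWithin_pos_measure
      (μ := multivariateGaussian (0 : EuclideanSpace ℝ (Fin M)) S) (s := Set.univ) (by simp)
    let μ : EuclideanSpace ℝ (Fin M) := p - c + (c i - p i + 1) • WithLp.toLp 2 (S i)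
    have hμi : μ i = 1 := by
      simp [μ, hii]
      ring
    have hzμ : z (μ + c) = z p := by
      rw [← hzline (c i - p i + 1)]
      congr 1
      simp only [μ]
      abel
    have hpos : 0 < (multivariateGaussian μ S).real (z ⁻¹' U) := by
      refine ENNReal.toReal_pos ?_ (measure_ne_top _ _)
      rw [multivariateGaussian_eq_map_add S μ, Measure.map_apply (measurable_const_add μ)
        (Metric.isOpen_ball.preimage hzc).measurableSet]
      refine (hc _ ?_).ne'
      rw [nhdsWithin_univ]
      refine (Metric.isOpen_ball.preimage (hzc.comp (continuous_const.add continuous_id))).mem_nhds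
        ?_
      change z (μ + c) ∈ U
      rw [hzμ]
      exact Metric.mem_ball_self hr
    refine ⟨μ, ?_⟩
    unfold testRisk
    rw [if_neg (by simp [hμi]), if_neg (by simp [hμi]), hψprob]
    have := mul_pos (hpower (μ i) (by simp [hμi])) hpos
    linarith

/-! ### Likelihood ratio statistics and intraclass quadratic forms -/

/-- The likelihood ratio statistic of a normal mean with known positive definite covariance is the
Mahalanobis quadratic form. -/
theorem likelihoodRatioStat_eq_quadratic {ι : Type} [Fintype ι] [DecidableEq ι] {S : Matrix ι ι ℝ}
    (hS : S.PosDef) (x : ι → ℝ) : likelihoodRatioStat S x = x ⬝ᵥ (S⁻¹ *ᵥ x) := by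
  have hc : 0 < (2 * Real.pi) ^ ((Fintype.card ι : ℝ) / 2) * √S.det :=
    mul_pos (Real.rpow_pos_of_pos (by positivity) _) (Real.sqrt_pos.2 hS.det_pos)
  have hmax : IsGreatest (Set.range fun μ => normalDensity S μ x) (normalDensity S x x) := by
    refine ⟨⟨x, rfl⟩, ?_⟩
    rintro _ ⟨μ, rfl⟩
    simp only [normalDensity, sub_self, zero_dotProduct, mul_zero]
    gcongr
    have := hS.inv.posSemidef.dotProduct_mulVec_nonneg (x - μ)
    simp only [star_trivial] at this
    linarith
  have hsup : ⨆ μ : ι → ℝ, normalDensity S μ x = normalDensity S x x := hmax.csSup_eq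
  rw [likelihoodRatioStat, hsup]
  simp only [normalDensity, sub_self, zero_dotProduct, mul_zero, sub_zero]
  rw [div_div_div_cancel_right₀ hc.ne', ← Real.exp_sub, Real.log_exp]
  ring

theorem posDef_intraclass (M : ℕ) {ρ : ℝ} (h₀ : 0 ≤ ρ) (h₁ : ρ < 1) : (intraclass M ρ).PosDef := by
  have h : intraclass M ρ = (1 - ρ) • (1 : Matrix (Fin M) (Fin M) ℝ)
      + ρ • Matrix.vecMulVec (fun _ => (1 : ℝ)) (star fun _ => (1 : ℝ)) := by
    ext i j
    by_cases hij : i = j <;> simp [intraclass, Matrix.vecMulVec_apply, hij]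
  rw [h]
  exact (Matrix.PosDef.one.smul (sub_pos.2 h₁)).add_posSemidef
    ((Matrix.posSemidef_vecMulVec_self_star _).smul h₀)

theorem posDef_subCov {M : ℕ} {S : Matrix (Fin M) (Fin M) ℝ} (hS : S.PosDef) (A : Finset (Fin M)) :
    (subCov S A).PosDef :=
  hS.submatrix Subtype.val_injective

theorem likelihoodRatioStat_subVec {M : ℕ} {S : Matrix (Fin M) (Fin M) ℝ} (hS : S.PosDef)
    (A : Finset (Fin M)) (x : EuclideanSpace ℝ (Fin M)) :
    likelihoodRatioStat (subCov S A) (subVec x A) = subQuad S A x :=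
  likelihoodRatioStat_eq_quadratic (posDef_subCov hS A) _

theorem subQuad_smul {M : ℕ} (S : Matrix (Fin M) (Fin M) ℝ) (A : Finset (Fin M)) (c : ℝ)
    (x : EuclideanSpace ℝ (Fin M)) : subQuad S A (c • x) = c ^ 2 * subQuad S A x := by
  have h : subVec (c • x) A = c • subVec x A := rfl
  rw [subQuad, h, Matrix.mulVec_smul, smul_dotProduct, dotProduct_smul, subQuad, smul_eq_mul,
    smul_eq_mul]
  ring

theorem continuous_subQuad {M : ℕ} (S : Matrix (Fin M) (Fin M) ℝ) (A : Finset (Fin M)) :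
    Continuous (subQuad S A) := by
  have h : Continuous fun x : EuclideanSpace ℝ (Fin M) => subVec x A := by
    unfold subVec
    fun_prop
  exact h.dotProduct (continuous_const.matrix_mulVec h)

theorem subQuad_pos {M : ℕ} {S : Matrix (Fin M) (Fin M) ℝ} (hS : S.PosDef) {A : Finset (Fin M)}
    {x : EuclideanSpace ℝ (Fin M)} {i : Fin M} (hi : i ∈ A) (hx : x i ≠ 0) : 0 < subQuad S A x := by
  have hne : subVec x A ≠ 0 := fun h => hx (congrFun h ⟨i, hi⟩)
  have := (posDef_subCov hS A).inv.dotProduct_mulVec_pos hne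
  rwa [star_trivial] at this

/-- This is the Sherman–Morrison formula: `Σ_A` is `(1 - ρ) I` plus `ρ` times the all-ones matrix,
so its inverse is `(I - κ 11') / (1 - ρ)`, with `κ` as in the proof. Nonemptiness of `A` keeps the
denominator of `κ` positive. -/
theorem subQuad_intraclass {M : ℕ} {ρ : ℝ} (h₀ : 0 ≤ ρ) (h₁ : ρ < 1) {A : Finset (Fin M)}
    (hA : A.Nonempty) (x : EuclideanSpace ℝ (Fin M)) :
    subQuad (intraclass M ρ) A x
      = (∑ i ∈ A, x i ^ 2 - ρ / (1 + (A.card - 1) * ρ) * (∑ i ∈ A, x i) ^ 2) / (1 - ρ) := by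
  have hρ : (1 - ρ) ≠ 0 := (sub_pos.2 h₁).ne'
  have hcard : (1 : ℝ) ≤ A.card := by exact_mod_cast hA.card_pos
  have hden : (1 + ((A.card : ℝ) - 1) * ρ) ≠ 0 := by
    have := mul_nonneg (sub_nonneg.2 hcard) h₀
    positivity
  set κ := ρ / (1 + ((A.card : ℝ) - 1) * ρ) with hκ
  have hκ' : κ * (1 - ρ) + ρ * A.card * κ = ρ := by
    have h : κ * (1 + ((A.card : ℝ) - 1) * ρ) = ρ := div_mul_cancel₀ _ hden
    linear_combination h
  set s := ∑ i ∈ A, x i with hs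
  -- The candidate for `Σ_A⁻¹ x_A`. Checking that `Σ_A w = x_A` replaces the computation of an
  -- inverse.
  let w : A → ℝ := fun i => (x i - κ * s) / (1 - ρ)
  have hsum : ∑ i, w i = (s - A.card * (κ * s)) / (1 - ρ) := by
    simp only [w]
    rw [← Finset.sum_div, Finset.sum_sub_distrib, Finset.sum_coe_sort A fun i => x i]
    simp [hs]
  have hw : subCov (intraclass M ρ) A *ᵥ w = subVec x A := by
    ext i
    have hrow : (subCov (intraclass M ρ) A *ᵥ w) i = (1 - ρ) * w i + ρ * ∑ j, w j := by
      simp only [Matrix.mulVec, dotProduct, subCov, intraclass, Matrix.submatrix_apply,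
        Matrix.of_apply]
      have : ∀ j : A, (if (i : Fin M) = j then 1 else ρ) * w j
          = (if i = j then (1 - ρ) * w j else 0) + ρ * w j := by
        intro j
        by_cases hij : i = j
        · simp [hij]; ring
        · simp [hij, Subtype.coe_injective.ne hij]
      rw [Finset.sum_congr rfl fun j _ => this j, Finset.sum_add_distrib, ← Finset.mul_sum]
      simp
    rw [hrow, hsum]
    simp only [w, subVec]
    field_simp
    linear_combination (-s) * hκ'
  have hinv : (subCov (intraclass M ρ) A)⁻¹ *ᵥ subVec x A = w := by
    rw [← hw, Matrix.mulVec_mulVec, Matrix.nonsing_inv_mul _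
      ((Matrix.isUnit_iff_isUnit_det _).1 (posDef_subCov (posDef_intraclass M h₀ h₁) A).isUnit),
      Matrix.one_mulVec]
  rw [subQuad, hinv]
  simp only [dotProduct, subVec, w]
  have : ∀ i : A, x i * ((x i - κ * s) / (1 - ρ)) = (x i ^ 2 - x i * (κ * s)) / (1 - ρ) :=
    fun i => by ring
  rw [Finset.sum_congr rfl fun i _ => this i, ← Finset.sum_div, Finset.sum_sub_distrib,
    Finset.sum_coe_sort A fun i => x i ^ 2, Finset.sum_coe_sort A fun i => x i * (κ * s),
    ← Finset.sum_mul, ← hs]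
  ring

/-! ### The step-down procedure: elimination and measurability -/

theorem IsLargest.eq {M : ℕ} {x : EuclideanSpace ℝ (Fin M)} {A : Finset (Fin M)} {i j : Fin M}
    (hi : IsLargest x A i) (hj : IsLargest x A j) : i = j := by
  have h := le_antisymm (hi.2 j hj.1).1 (hj.2 i hi.1).1
  exact le_antisymm ((hi.2 j hj.1).2 h) ((hj.2 i hi.1).2 h.symm)

theorem isLargest_of_lt {M : ℕ} {x : EuclideanSpace ℝ (Fin M)} {A : Finset (Fin M)} {i : Fin M}
    (hi : i ∈ A) (h : ∀ j ∈ A, j ≠ i → |x j| < |x i|) : IsLargest x A i := by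
  refine ⟨hi, fun j hj => ?_⟩
  rcases eq_or_ne j i with rfl | hji
  · exact ⟨le_rfl, fun _ => le_rfl⟩
  · exact ⟨(h j hj hji).le, fun he => absurd he (h j hj hji).ne⟩

theorem remaining_succ {M : ℕ} {x : EuclideanSpace ℝ (Fin M)} {m : ℕ} {i : Fin M}
    (hi : IsLargest x (remaining x m) i) : remaining x (m + 1) = (remaining x m).erase i := by
  ext j
  simp only [remaining, Finset.mem_filter]
  rw [Finset.mem_erase, and_comm]
  refine and_congr_left fun _ => not_congr ⟨fun hj => hj.eq hi, ?_⟩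
  rintro rfl
  exact hi

theorem lrsdRejects_iff {M : ℕ} {S : Matrix (Fin M) (Fin M) ℝ} (hS : S.PosDef) (C : Fin M → ℝ)
    (x : EuclideanSpace ℝ (Fin M)) (i : Fin M) :
    LRSDRejects S C x i ↔ ∃ m : Fin M, IsLargest x (remaining x m) i ∧
      ∀ k ≤ m, C k ≤ subQuad S (remaining x k) x := by
  simp only [LRSDRejects, likelihoodRatioStat_subVec hS]

/-- A step-down procedure whose second stage accepts can reject only at the first stage. -/
theorem lrsdRejects_iff_of_stage_two_lt {n : ℕ} {S : Matrix (Fin (n + 2)) (Fin (n + 2)) ℝ}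
    (hS : S.PosDef) {C : Fin (n + 2) → ℝ} {x : EuclideanSpace ℝ (Fin (n + 2))} {j : Fin (n + 2)}
    (hj : IsLargest x Finset.univ j) (hC : subQuad S (Finset.univ.erase j) x < C 1)
    (i : Fin (n + 2)) : LRSDRejects S C x i ↔ i = j ∧ C 0 ≤ subQuad S Finset.univ x := by
  have h1 : remaining x 1 = Finset.univ.erase j := remaining_succ (m := 0) hj
  rw [lrsdRejects_iff hS]
  constructor
  · rintro ⟨m, hm, hk⟩
    rcases eq_or_ne m 0 with rfl | hm0
    · exact ⟨hm.eq hj, hk 0 le_rfl⟩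
    · have := hk 1 (Fin.one_le_of_ne_zero hm0)
      simp only [Fin.val_one] at this
      rw [h1] at this
      exact absurd this (not_le.2 hC)
  · rintro ⟨rfl, h0⟩
    refine ⟨0, hj, fun k hk => ?_⟩
    rw [Fin.le_zero_iff.1 hk]
    exact h0

theorem measurable_isLargest {M : ℕ} (A : Finset (Fin M)) (i : Fin M) :
    Measurable fun x : EuclideanSpace ℝ (Fin M) => IsLargest x A i := by
  have hx : ∀ j, Measurable fun x : EuclideanSpace ℝ (Fin M) => |x j| := fun j =>
    Continuous.measurable (by fun_prop)
  refine Measurable.and measurable_const (Measurable.forall fun j => Measurable.imp measurable_const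
    (Measurable.and ?_ (Measurable.imp ?_ measurable_const)))
  · exact measurableSet_setOfPred.1 (measurableSet_le (hx j) (hx i))
  · exact measurableSet_setOfPred.1 (measurableSet_eq_fun (hx j) (hx i))

/-- There are only finitely many index sets, so the random set of remaining indices can be handled
through its level sets, and the next level set is a finite union over the possible previous sets. -/
theorem measurable_remaining_eq {M : ℕ} (m : ℕ) (A : Finset (Fin M)) :
    Measurable fun x : EuclideanSpace ℝ (Fin M) => remaining x m = A := by
  induction m generalizing A with
  | zero => exact measurable_const (a := Finset.univ = A)
  | succ m ih =>
    have h : (fun x : EuclideanSpace ℝ (Fin M) => remaining x (m + 1) = A) = fun x =>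
        ∃ B, remaining x m = B ∧ ∀ i, (i ∈ B ∧ ¬ IsLargest x B i) ↔ i ∈ A := by
      ext x
      simp only [exists_eq_left']
      simp only [remaining, Finset.ext_iff, Finset.mem_filter]
    rw [h]
    exact Measurable.exists fun B => (ih B).and (Measurable.forall fun i =>
      ((measurable_const.and (measurable_isLargest B i).not).iff measurable_const))

theorem isTest_lrsdTest {M : ℕ} {S : Matrix (Fin M) (Fin M) ℝ} (hS : S.PosDef) (C : Fin M → ℝ)
    (i : Fin M) : IsTest (lrsdTest S C i) := by
  have hm : Measurable fun x : EuclideanSpace ℝ (Fin M) => LRSDRejects S C x i := by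
    have h : (fun x : EuclideanSpace ℝ (Fin M) => LRSDRejects S C x i) = fun x =>
        ∃ m : Fin M, (∃ B, remaining x m = B ∧ IsLargest x B i) ∧
          ∀ k, k ≤ m → ∃ B, remaining x k = B ∧ C k ≤ subQuad S B x := by
      ext x
      simp only [exists_eq_left', lrsdRejects_iff hS]
    rw [h]
    refine Measurable.exists fun m => Measurable.and
      (Measurable.exists fun B => (measurable_remaining_eq _ B).and (measurable_isLargest B i))
      (Measurable.forall fun k => Measurable.imp measurable_const (Measurable.exists fun B =>
        (measurable_remaining_eq _ B).and ?_))
    exact measurableSet_setOfPred.1 (measurableSet_le measurable_const (continuous_subQuad S B).measurable)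
  refine ⟨Measurable.ite (measurableSet_setOfPred.2 hm) measurable_const measurable_const, fun x => ?_⟩
  unfold lrsdTest
  split_ifs <;> norm_num

theorem lrsdTest_eq_one_iff {M : ℕ} {S : Matrix (Fin M) (Fin M) ℝ} {C : Fin M → ℝ} {i : Fin M}
    {x : EuclideanSpace ℝ (Fin M)} : lrsdTest S C i x = 1 ↔ LRSDRejects S C x i := by
  unfold lrsdTest
  split_ifs <;> simpa

theorem lrsdTest_eq_zero_iff {M : ℕ} {S : Matrix (Fin M) (Fin M) ℝ} {C : Fin M → ℝ} {i : Fin M}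
    {x : EuclideanSpace ℝ (Fin M)} : lrsdTest S C i x = 0 ↔ ¬ LRSDRejects S C x i := by
  unfold lrsdTest
  split_ifs <;> simpa

/-- Identifies the section in `y_i` through `x` with the line through `x` in the direction of the
`i`-th column, which is how the acceptance section is read on sample points. -/
theorem mulVec_update_inv_mulVec {M : ℕ} {S : Matrix (Fin M) (Fin M) ℝ} (hS : S.PosDef) (i : Fin M)
    (x : EuclideanSpace ℝ (Fin M)) (c : ℝ) :
    WithLp.toLp 2 (S *ᵥ Function.update (S⁻¹ *ᵥ x.ofLp) i ((S⁻¹ *ᵥ x.ofLp) i + c))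
      = x + c • WithLp.toLp 2 fun j => S j i := by
  have h : Function.update (S⁻¹ *ᵥ x.ofLp) i ((S⁻¹ *ᵥ x.ofLp) i + c)
      = S⁻¹ *ᵥ x.ofLp + Pi.single i c := by
    ext j
    rcases eq_or_ne j i with rfl | hji
    · simp
    · simp [hji]
  rw [h, Matrix.mulVec_add, Matrix.mulVec_mulVec, Matrix.mul_nonsing_inv _
    ((Matrix.isUnit_iff_isUnit_det _).1 hS.isUnit), Matrix.one_mulVec, Matrix.mulVec_single]
  ext j
  simp

/-! ### Explicit statistics at `x*` and along the line in direction `g` -/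

theorem toLp_intraclass_row (ρ : ℝ) :
    WithLp.toLp 2 (intraclass 4 ρ 0) = gVec ρ := by
  ext j
  simp only [gVec, intraclass, Matrix.of_apply, eq_comm]

theorem xStar_add_smul_gVec (a b Δ ε ρ c : ℝ) :
    xStar a b Δ ε + c • gVec ρ
      = !₂[a + c, -a - Δ + c * ρ, b + c * ρ, -b - ε + c * ρ] := by
  ext j
  fin_cases j <;> simp [xStar, gVec, intraclass]

theorem subQuad_zero_one_two {ρ : ℝ} (h₀ : 0 < ρ) (h₁ : ρ < 1) (x : EuclideanSpace ℝ (Fin 4)) :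
    subQuad (intraclass 4 ρ) {0, 1, 2} x
      = (x 0 ^ 2 + x 1 ^ 2 + x 2 ^ 2 - ρ / (1 + 2 * ρ) * (x 0 + x 1 + x 2) ^ 2) / (1 - ρ) := by
  rw [subQuad_intraclass h₀.le h₁ ⟨0, by decide⟩, show ({0, 1, 2} : Finset (Fin 4)).card = 3 by rfl,
    show ∀ f : Fin 4 → ℝ, ∑ i ∈ {0, 1, 2}, f i = f 0 + f 1 + f 2 from fun f => by
      simp [Finset.sum_insert, add_assoc],
    show ∀ f : Fin 4 → ℝ, ∑ i ∈ {0, 1, 2}, f i = f 0 + f 1 + f 2 from fun f => by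
      simp [Finset.sum_insert, add_assoc]]
  norm_num

theorem subQuad_zero_one_three {ρ : ℝ} (h₀ : 0 < ρ) (h₁ : ρ < 1) (x : EuclideanSpace ℝ (Fin 4)) :
    subQuad (intraclass 4 ρ) {0, 1, 3} x
      = (x 0 ^ 2 + x 1 ^ 2 + x 3 ^ 2 - ρ / (1 + 2 * ρ) * (x 0 + x 1 + x 3) ^ 2) / (1 - ρ) := by
  rw [subQuad_intraclass h₀.le h₁ ⟨0, by decide⟩, show ({0, 1, 3} : Finset (Fin 4)).card = 3 by rfl,
    show ∀ f : Fin 4 → ℝ, ∑ i ∈ {0, 1, 3}, f i = f 0 + f 1 + f 3 from fun f => by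
      simp [Finset.sum_insert, add_assoc],
    show ∀ f : Fin 4 → ℝ, ∑ i ∈ {0, 1, 3}, f i = f 0 + f 1 + f 3 from fun f => by
      simp [Finset.sum_insert, add_assoc]]
  norm_num

theorem subQuad_univ_four {ρ : ℝ} (h₀ : 0 < ρ) (h₁ : ρ < 1) (x : EuclideanSpace ℝ (Fin 4)) :
    subQuad (intraclass 4 ρ) Finset.univ x
      = (x 0 ^ 2 + x 1 ^ 2 + x 2 ^ 2 + x 3 ^ 2
        - ρ / (1 + 3 * ρ) * (x 0 + x 1 + x 2 + x 3) ^ 2) / (1 - ρ) := by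
  rw [subQuad_intraclass h₀.le h₁ ⟨0, Finset.mem_univ _⟩, Fin.sum_univ_four, Fin.sum_univ_four]
  norm_num

theorem subQuad_xStar {a b Δ ε ρ : ℝ} (h₀ : 0 < ρ) (h₁ : ρ < 1) :
    subQuad (intraclass 4 ρ) {0, 1, 2} (xStar a b Δ ε) = stageTwoStat a b Δ ρ := by
  have hρ : 1 - ρ ≠ 0 := (sub_pos.2 h₁).ne'
  rw [subQuad_zero_one_two h₀ h₁, stageTwoStat,
    show 1 + ρ - 2 * ρ ^ 2 = (1 - ρ) * (1 + 2 * ρ) by ring]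
  simp only [xStar, PiLp.toLp_apply, Matrix.cons_val]
  field_simp
  ring

theorem subQuad_xStar_sub_subQuad {a b Δ ε ρ : ℝ} (h₀ : 0 < ρ) (h₁ : ρ < 1) :
    subQuad (intraclass 4 ρ) {0, 1, 2} (xStar a b Δ ε)
      - subQuad (intraclass 4 ρ) {0, 1, 3} (xStar a b Δ ε + (ε / ρ) • gVec ρ)
      = stageTwoGap a b Δ ε ρ := by
  have hρ : 1 - ρ ≠ 0 := (sub_pos.2 h₁).ne'
  rw [xStar_add_smul_gVec, subQuad_zero_one_two h₀ h₁, subQuad_zero_one_three h₀ h₁, stageTwoGap,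
    show 1 + ρ - 2 * ρ ^ 2 = (1 - ρ) * (1 + 2 * ρ) by ring]
  simp only [xStar, PiLp.toLp_apply, Matrix.cons_val]
  field_simp
  ring

/-- The stage-two statistic does not reach its value at `x*` at the point of the line through `x*` in
the direction `g` whose first coordinate vanishes. -/
theorem subQuad_xStar_sub_smul_gVec {a b Δ ε ρ : ℝ} (h₀ : 0 < ρ) (h₁ : ρ < 1) :
    subQuad (intraclass 4 ρ) {0, 1, 2} (xStar a b Δ ε - a • gVec ρ)
      = subQuad (intraclass 4 ρ) {0, 1, 2} (xStar a b Δ ε) - a ^ 2 := by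
  have hρ : 1 - ρ ≠ 0 := (sub_pos.2 h₁).ne'
  rw [sub_eq_add_neg, ← neg_smul, xStar_add_smul_gVec, subQuad_zero_one_two h₀ h₁,
    subQuad_zero_one_two h₀ h₁]
  simp only [xStar, PiLp.toLp_apply, Matrix.cons_val]
  field_simp
  ring

/-- As `Σ⁻¹ g` is the first unit vector, the cross term is `2 c x_1` with `x_1 = a`, and `g' Σ⁻¹ g =
1`. The same reason on `{0, 1, 2}`, with `c = -a`, gives the drop `a ^ 2`. -/
theorem subQuad_univ_xStar_add_smul_gVec {a b Δ ε ρ : ℝ} (h₀ : 0 < ρ) (h₁ : ρ < 1) (c : ℝ) :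
    subQuad (intraclass 4 ρ) Finset.univ (xStar a b Δ ε + c • gVec ρ)
      = subQuad (intraclass 4 ρ) Finset.univ (xStar a b Δ ε) + 2 * a * c + c ^ 2 := by
  have hρ : 1 - ρ ≠ 0 := (sub_pos.2 h₁).ne'
  rw [xStar_add_smul_gVec, subQuad_univ_four h₀ h₁, subQuad_univ_four h₀ h₁]
  simp only [xStar, PiLp.toLp_apply, Matrix.cons_val]
  field_simp
  ring

/-- Adding a coordinate raises the quadratic form by its squared regression residual over its
conditional variance. The residual of the fourth coordinate on the other three is nonzero at `x*`.
This leaves room for `C 0 > C 1`. -/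
theorem subQuad_lt_subQuad_univ_xStar {a b Δ ε ρ : ℝ} (ha : 0 < a) (hΔ : 0 < Δ) (hb : a + Δ < b) (hε : 0 < ε)
    (h₀ : 0 < ρ) (h₁ : ρ < 1) :
    subQuad (intraclass 4 ρ) {0, 1, 2} (xStar a b Δ ε)
      < subQuad (intraclass 4 ρ) Finset.univ (xStar a b Δ ε) := by
  have hρ : 0 < 1 - ρ := sub_pos.2 h₁
  have hd : 0 < (1 + 2 * ρ) * (b + ε) + ρ * (b - Δ) := by
    have : 0 < b - Δ := by linarith
    have : 0 < b := by linarith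
    positivity
  rw [← sub_pos]
  have : subQuad (intraclass 4 ρ) Finset.univ (xStar a b Δ ε)
      - subQuad (intraclass 4 ρ) {0, 1, 2} (xStar a b Δ ε)
      = ((1 + 2 * ρ) * (b + ε) + ρ * (b - Δ)) ^ 2
        / ((1 - ρ) * (1 + 2 * ρ) * (1 + 3 * ρ)) := by
    rw [subQuad_univ_four h₀ h₁, subQuad_zero_one_two h₀ h₁]
    simp only [xStar, PiLp.toLp_apply, Matrix.cons_val]
    have := hρ.ne'
    field_simp
    ring
  rw [this]
  positivity

/-- If the stage-two statistic drops between `x*` and `x* + (ε / ρ) g`, then the third coordinate is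
still the largest one at the latter point. -/
theorem add_div_lt_of_stageTwoGap_pos {a b Δ ε ρ : ℝ} (ha : 0 < a) (hΔ : 0 < Δ) (hb : a + Δ < b)
    (hε : 0 < ε) (h₀ : 0 < ρ) (h₁ : ρ < 1) (hD : 0 < stageTwoGap a b Δ ε ρ) :
    a + ε / ρ < b + ε := by
  by_contra! hcon
  have hρ : 0 < 1 - ρ := sub_pos.2 h₁
  set c := ε / ρ with hc
  have hεc : ε = c * ρ := (div_mul_cancel₀ _ h₀.ne').symm
  have hc0 : 0 < c := by positivity
  have hgap : 0 < 4 * Δ * b * ρ - c ^ 2 * (1 + ρ - ρ ^ 2 + ρ ^ 3)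
      - c * (2 * a * (1 - ρ) * (1 + 2 * ρ) + 2 * ρ * b + 2 * ρ ^ 2 * (b - Δ)) := by
    have hpos : 0 < 1 + ρ - 2 * ρ ^ 2 := by nlinarith
    have h := mul_pos hpos hD
    rw [stageTwoGap, ← mul_assoc, mul_one_div_cancel hpos.ne', one_mul, hεc] at h
    have e₁ : (c * ρ) ^ 2 * (ρ - 1 + 1 / ρ + 1 / ρ ^ 2) = c ^ 2 * (1 + ρ - ρ ^ 2 + ρ ^ 3) := by
      field_simp
      ring
    have e₂ : c * ρ * (2 * a / ρ + 2 * a - 4 * a * ρ - 2 * ρ * Δ + 2 * (1 + ρ) * b)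
        = c * (2 * a * (1 - ρ) * (1 + 2 * ρ) + 2 * ρ * b + 2 * ρ ^ 2 * (b - Δ)) := by
      field_simp
      ring
    rwa [e₁, e₂] at h
  -- If the claim failed, `c` would be at least `(b - a) / (1 - ρ)`. With `d = b - a > Δ`, the
  -- positive term of the gap is at most `4 ρ d (a + d)`, while `h1`, `h2`, `h3` bound the negative
  -- terms below by a total that is larger by `2 a d (1 + ρ) + d ^ 2`.
  have hcd : b - a ≤ c * (1 - ρ) := by rw [hεc] at hcon; linarith
  set d := b - a with hd
  have hd0 : 0 < d := by linarith
  have hdc : d ≤ c := by nlinarith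
  have hΔd : Δ < d := by linarith
  have hbd : b = a + d := by rw [hd]; ring
  have hdρ : d * (1 + ρ) ≤ c := by nlinarith [mul_le_mul_of_nonneg_right hcd (by linarith : 0 ≤ 1 + ρ), mul_pos hc0 (mul_pos h₀ h₀)]
  have h1 : d * (2 * a * (1 + 2 * ρ)) ≤ c * (2 * a * (1 - ρ) * (1 + 2 * ρ)) := by
    have := mul_le_mul_of_nonneg_right hcd (by positivity : 0 ≤ 2 * a * (1 + 2 * ρ))
    linarith
  have h2 : d * (2 * ρ * b) ≤ c * (2 * ρ * b) :=
    mul_le_mul_of_nonneg_right hdc (by rw [hbd]; positivity)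
  have h3 : d ^ 2 * (1 + 2 * ρ) ≤ c ^ 2 * (1 + ρ - ρ ^ 2 + ρ ^ 3) := by
    have hsq : (d * (1 + ρ)) ^ 2 ≤ c ^ 2 := pow_le_pow_left₀ (by positivity) hdρ 2
    have hone : 1 ≤ 1 + ρ - ρ ^ 2 + ρ ^ 3 := by nlinarith [mul_pos h₀ hρ, pow_pos h₀ 3]
    nlinarith [mul_le_mul_of_nonneg_left hone (sq_nonneg c), mul_pos (mul_pos hd0 hd0) (mul_pos h₀ h₀)]
  have h4 : 0 ≤ c * (2 * ρ ^ 2 * (b - Δ)) := by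
    have : 0 < b - Δ := by linarith
    positivity
  have h5 : Δ * (4 * b * ρ) ≤ d * (4 * b * ρ) :=
    mul_le_mul_of_nonneg_right hΔd.le (by rw [hbd]; positivity)
  rw [hbd] at h2 h5 hgap h4
  nlinarith [mul_pos hd0 ha, mul_pos hd0 hd0]

/-- `C 0` fits between the first two statistics, `C 1` is prescribed, and `C 2`, `C 3` need only be
small, since all statistics involved are positive because `x*_1 = a` is. -/
theorem exists_criticalChoice {a b Δ ε ρ : ℝ} (ha : 0 < a) (hΔ : 0 < Δ) (hb : a + Δ < b)
    (hε : 0 < ε) (h₀ : 0 < ρ) (h₁ : ρ < 1) : ∃ C : Fin 4 → ℝ, CriticalChoice a b Δ ε ρ C := by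
  have hpos : ∀ A : Finset (Fin 4), 0 ∈ A → 0 < subQuad (intraclass 4 ρ) A (xStar a b Δ ε) :=
    fun A hA => subQuad_pos (posDef_intraclass 4 h₀.le h₁) hA (by simpa [xStar] using ha.ne')
  obtain ⟨c₀, h₁₀, hc₀⟩ := exists_between (subQuad_lt_subQuad_univ_xStar ha hΔ hb hε h₀ h₁)
  obtain ⟨c₂, hc₂, hc₂'⟩ := exists_between
    (lt_min (hpos {0, 1, 2} (by decide)) (hpos {0, 1} (by decide)))
  obtain ⟨c₃, hc₃, hc₃'⟩ := exists_between (lt_min hc₂ (hpos {0} (by decide)))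
  rw [lt_min_iff] at hc₂' hc₃'
  refine ⟨![c₀, subQuad (intraclass 4 ρ) {0, 1, 2} (xStar a b Δ ε), c₂, c₃], ?_⟩
  simp only [CriticalChoice, Matrix.cons_val]
  exact ⟨h₁₀, hc₂'.1, hc₃'.1, hc₃, hc₀, trivial, hc₂'.2.le, hc₃'.2.le⟩

/-! ### Decisions of the procedure and their stability -/

theorem lrsdRejects_of_strictMono_abs {S : Matrix (Fin 4) (Fin 4) ℝ} (hS : S.PosDef)
    {C : Fin 4 → ℝ} {x : EuclideanSpace ℝ (Fin 4)}
    (h₀₁ : |x 0| < |x 1|) (h₁₂ : |x 1| < |x 2|) (h₂₃ : |x 2| < |x 3|)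
    (hC₀ : C 0 ≤ subQuad S Finset.univ x) (hC₁ : C 1 ≤ subQuad S {0, 1, 2} x)
    (hC₂ : C 2 ≤ subQuad S {0, 1} x) (hC₃ : C 3 ≤ subQuad S {0} x) (i : Fin 4) :
    LRSDRejects S C x i := by
  have l₀ : IsLargest x (remaining x 0) 3 := isLargest_of_lt (Finset.mem_univ _) fun j _ hj => by
    fin_cases j <;> first | exact absurd rfl hj | skip
    exacts [(h₀₁.trans h₁₂).trans h₂₃, h₁₂.trans h₂₃, h₂₃]
  have r₁ : remaining x 1 = {0, 1, 2} := remaining_succ l₀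
  have l₁ : IsLargest x (remaining x 1) 2 := by
    rw [r₁]
    refine isLargest_of_lt (by decide) fun j hj hj' => ?_
    fin_cases j <;> first | exact absurd rfl hj' | exact absurd hj (by decide) | skip
    exacts [h₀₁.trans h₁₂, h₁₂]
  have r₂ : remaining x 2 = {0, 1} := (remaining_succ l₁).trans (by rw [r₁]; decide)
  have l₂ : IsLargest x (remaining x 2) 1 := by
    rw [r₂]
    refine isLargest_of_lt (by decide) fun j hj hj' => ?_
    fin_cases j <;> first | exact absurd rfl hj' | exact absurd hj (by decide) | skip
    exact h₀₁
  have r₃ : remaining x 3 = {0} := (remaining_succ l₂).trans (by rw [r₂]; decide)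
  have l₃ : IsLargest x (remaining x 3) 0 := by
    rw [r₃]
    exact isLargest_of_lt (by decide) fun j hj hj' => absurd (Finset.mem_singleton.1 hj) hj'
  have hk : ∀ k : Fin 4, C k ≤ subQuad S (remaining x k) x := by
    intro k
    fin_cases k
    · exact hC₀
    · change C 1 ≤ subQuad S (remaining x 1) x
      rwa [r₁]
    · change C 2 ≤ subQuad S (remaining x 2) x
      rwa [r₂]
    · change C 3 ≤ subQuad S (remaining x 3) x
      rwa [r₃]
  rw [lrsdRejects_iff hS]
  fin_cases i
  exacts [⟨3, l₃, fun k _ => hk k⟩, ⟨2, l₂, fun k _ => hk k⟩, ⟨1, l₁, fun k _ => hk k⟩,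
    ⟨0, l₀, fun k _ => hk k⟩]

theorem eventually_abs_lt_of_abs_lt {M : ℕ} {x : EuclideanSpace ℝ (Fin M)} {i j : Fin M}
    (h : |x i| < |x j|) : ∀ᶠ y in nhds x, |y i| < |y j| :=
  (by fun_prop : Continuous fun y : EuclideanSpace ℝ (Fin M) => |y i|).continuousAt.eventually_lt
    (by fun_prop : Continuous fun y : EuclideanSpace ℝ (Fin M) => |y j|).continuousAt h

/-- Acceptance of a hypothesis is stable under small changes of the sample if the second stage
accepts strictly and the first stage strictly selects another hypothesis. -/
theorem eventually_lrsdTest_eq_zero {n : ℕ} {S : Matrix (Fin (n + 2)) (Fin (n + 2)) ℝ}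
    (hS : S.PosDef) {C : Fin (n + 2) → ℝ} {x : EuclideanSpace ℝ (Fin (n + 2))} {i j : Fin (n + 2)}
    (hij : i ≠ j) (hj : ∀ k, k ≠ j → |x k| < |x j|)
    (hC : subQuad S (Finset.univ.erase j) x < C 1) :
    ∀ᶠ y in nhds x, lrsdTest S C i y = 0 := by
  have h : ∀ᶠ y in nhds x, ∀ k, k ≠ j → |y k| < |y j| :=
    Filter.eventually_all.2 fun k => Filter.eventually_imp_distrib_left.2 fun hk =>
      eventually_abs_lt_of_abs_lt (hj k hk)
  filter_upwards [h, (continuous_subQuad S _).continuousAt.eventually_lt continuousAt_const hC]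
    with y hy hyC
  rw [lrsdTest_eq_zero_iff, lrsdRejects_iff_of_stage_two_lt hS
    (isLargest_of_lt (Finset.mem_univ j) fun k _ hk => hy k hk) hyC]
  exact fun hi => hij hi.1

theorem eventually_lrsdTest_eq_one {S : Matrix (Fin 4) (Fin 4) ℝ} (hS : S.PosDef)
    {C : Fin 4 → ℝ} {x : EuclideanSpace ℝ (Fin 4)}
    (h₀₁ : |x 0| < |x 1|) (h₁₂ : |x 1| < |x 2|) (h₂₃ : |x 2| < |x 3|)
    (hC₀ : C 0 < subQuad S Finset.univ x) (hC₁ : C 1 < subQuad S {0, 1, 2} x)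
    (hC₂ : C 2 < subQuad S {0, 1} x) (hC₃ : C 3 < subQuad S {0} x) (i : Fin 4) :
    ∀ᶠ y in nhds x, lrsdTest S C i y = 1 := by
  have hQ : ∀ {c : ℝ} {A : Finset (Fin 4)}, c < subQuad S A x → ∀ᶠ y in nhds x, c < subQuad S A y :=
    fun h => continuousAt_const.eventually_lt (continuous_subQuad S _).continuousAt h
  filter_upwards [eventually_abs_lt_of_abs_lt h₀₁, eventually_abs_lt_of_abs_lt h₁₂,
    eventually_abs_lt_of_abs_lt h₂₃, hQ hC₀, hQ hC₁, hQ hC₂, hQ hC₃] with y y₁ y₂ y₃ q₀ q₁ q₂ q₃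
  exact lrsdTest_eq_one_iff.2
    (lrsdRejects_of_strictMono_abs hS y₁ y₂ y₃ q₀.le q₁.le q₂.le q₃.le i)

/-! ### The three points under the prescribed critical values -/

section CriticalValues

variable {a b Δ ε ρ : ℝ} {C : Fin 4 → ℝ}

theorem abs_xStar_strictMono (ha : 0 < a) (hΔ : 0 < Δ) (hb : a + Δ < b) (hε : 0 < ε) :
    |xStar a b Δ ε 0| < |xStar a b Δ ε 1| ∧ |xStar a b Δ ε 1| < |xStar a b Δ ε 2| ∧
      |xStar a b Δ ε 2| < |xStar a b Δ ε 3| := by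
  simp only [xStar, PiLp.toLp_apply, Matrix.cons_val]
  rw [abs_of_pos ha, abs_of_neg (by linarith : -a - Δ < 0), abs_of_pos (by linarith : 0 < b),
    abs_of_neg (by linarith : -b - ε < 0)]
  refine ⟨?_, ?_, ?_⟩ <;> linarith

theorem lrsdRejects_xStar (ha : 0 < a) (hΔ : 0 < Δ) (hb : a + Δ < b) (hε : 0 < ε)
    (h₀ : 0 < ρ) (h₁ : ρ < 1) (hC : CriticalChoice a b Δ ε ρ C) (i : Fin 4) :
    LRSDRejects (intraclass 4 ρ) C (xStar a b Δ ε) i := by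
  obtain ⟨-, -, -, -, c₀, c₁, c₂, c₃⟩ := hC
  obtain ⟨m₁, m₂, m₃⟩ := abs_xStar_strictMono ha hΔ hb hε
  exact lrsdRejects_of_strictMono_abs (posDef_intraclass 4 h₀.le h₁) m₁ m₂ m₃ c₀.le c₁.le c₂ c₃ i

/-- At `x*` the second-stage inequality is an equality, so rejection need not persist nearby.
Scaling by `c > 1` keeps the elimination order and multiplies every statistic by `c ^ 2`, which
makes all inequalities strict. -/
theorem eventually_lrsdTest_eq_one_smul_xStar (ha : 0 < a) (hΔ : 0 < Δ) (hb : a + Δ < b)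
    (hε : 0 < ε) (h₀ : 0 < ρ) (h₁ : ρ < 1) (hC : CriticalChoice a b Δ ε ρ C) {c : ℝ} (hc : 1 < c)
    (i : Fin 4) :
    ∀ᶠ y in nhds (c • xStar a b Δ ε), lrsdTest (intraclass 4 ρ) C i y = 1 := by
  have hS := posDef_intraclass 4 h₀.le h₁
  obtain ⟨-, -, -, -, c₀, c₁, c₂, c₃⟩ := hC
  obtain ⟨m₁, m₂, m₃⟩ := abs_xStar_strictMono ha hΔ hb hε
  have hc0 : 0 < |c| := abs_pos.2 (by linarith)
  have hm : ∀ {i j : Fin 4}, |xStar a b Δ ε i| < |xStar a b Δ ε j| →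
      |(c • xStar a b Δ ε) i| < |(c • xStar a b Δ ε) j| := by
    intro i j h
    simp only [PiLp.smul_apply, smul_eq_mul, abs_mul]
    exact mul_lt_mul_of_pos_left h hc0
  have hQ : ∀ {A : Finset (Fin 4)} {k : ℝ}, 0 ∈ A →
      k ≤ subQuad (intraclass 4 ρ) A (xStar a b Δ ε) →
      k < subQuad (intraclass 4 ρ) A (c • xStar a b Δ ε) := by
    intro A k hA h
    have hpos : 0 < subQuad (intraclass 4 ρ) A (xStar a b Δ ε) :=
      subQuad_pos hS hA (by simpa [xStar] using ha.ne')
    rw [subQuad_smul]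
    refine h.trans_lt (lt_mul_of_one_lt_left hpos ?_)
    nlinarith
  exact eventually_lrsdTest_eq_one hS (hm m₁) (hm m₂) (hm m₃) (hQ (Finset.mem_univ _) c₀.le)
    (hQ (by decide) c₁.le) (hQ (by decide) c₂) (hQ (by decide) c₃) i

/-- The coordinates of the point are `a + ε / ρ`, `-a - Δ + ε`, `b + ε` and `-b`. Only the
comparison with the first one needs `D > 0`. -/
theorem abs_xStar_add_smul_gVec_lt (ha : 0 < a) (hΔ : 0 < Δ) (hb : a + Δ < b) (hε : 0 < ε)
    (h₀ : 0 < ρ) (h₁ : ρ < 1) (hD : 0 < stageTwoGap a b Δ ε ρ) (k : Fin 4) (hk : k ≠ 2) :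
    |(xStar a b Δ ε + (ε / ρ) • gVec ρ) k| < |(xStar a b Δ ε + (ε / ρ) • gVec ρ) 2| := by
  have hlt := add_div_lt_of_stageTwoGap_pos ha hΔ hb hε h₀ h₁ hD
  have hc : 0 < ε / ρ := div_pos hε h₀
  have hε' : ε / ρ * ρ = ε := div_mul_cancel₀ _ h₀.ne'
  rw [xStar_add_smul_gVec, hε']
  have h2 : |b + ε| = b + ε := abs_of_pos (by linarith)
  fin_cases k <;> simp only [Matrix.cons_val, Fin.zero_eta, Fin.mk_one,
    Fin.reduceFinMk] <;> first | exact absurd rfl hk | (rw [h2, abs_lt]; constructor <;> linarith)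

theorem subQuad_erase_two_lt (hD : 0 < stageTwoGap a b Δ ε ρ) (h₀ : 0 < ρ) (h₁ : ρ < 1)
    (hC : CriticalChoice a b Δ ε ρ C) :
    subQuad (intraclass 4 ρ) (Finset.univ.erase 2) (xStar a b Δ ε + (ε / ρ) • gVec ρ) < C 1 := by
  rw [show (Finset.univ.erase 2 : Finset (Fin 4)) = {0, 1, 3} by decide, hC.2.2.2.2.2.1]
  linarith [subQuad_xStar_sub_subQuad (a := a) (b := b) (Δ := Δ) (ε := ε) h₀ h₁]

theorem abs_xStar_sub_smul_gVec_lt (ha : 0 < a) (hΔ : 0 < Δ) (hb : a + Δ < b) (hε : 0 < ε)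
    (h₀ : 0 < ρ) (k : Fin 4) (hk : k ≠ 3) :
    |(xStar a b Δ ε - a • gVec ρ) k| < |(xStar a b Δ ε - a • gVec ρ) 3| := by
  have hρ : 0 < a * ρ := mul_pos ha h₀
  rw [sub_eq_add_neg, ← neg_smul, xStar_add_smul_gVec]
  have h3 : |-b - ε + -a * ρ| = b + ε + a * ρ := by
    rw [abs_of_neg (by linarith)]
    ring
  fin_cases k <;> simp only [Matrix.cons_val, Fin.zero_eta, Fin.mk_one,
    Fin.reduceFinMk] <;> first | exact absurd rfl hk | (rw [h3, abs_lt]; constructor <;> linarith)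

theorem subQuad_erase_three_lt (ha : 0 < a) (h₀ : 0 < ρ) (h₁ : ρ < 1)
    (hC : CriticalChoice a b Δ ε ρ C) :
    subQuad (intraclass 4 ρ) (Finset.univ.erase 3) (xStar a b Δ ε - a • gVec ρ) < C 1 := by
  rw [show (Finset.univ.erase 3 : Finset (Fin 4)) = {0, 1, 2} by decide, hC.2.2.2.2.2.1,
    subQuad_xStar_sub_smul_gVec h₀ h₁]
  linarith [pow_pos ha 2]

theorem lt_subQuad_univ_xStar_add_smul_gVec (ha : 0 < a) (hε : 0 < ε) (h₀ : 0 < ρ) (h₁ : ρ < 1)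
    (hC : CriticalChoice a b Δ ε ρ C) :
    C 0 < subQuad (intraclass 4 ρ) Finset.univ (xStar a b Δ ε + (ε / ρ) • gVec ρ) := by
  have hc : 0 < ε / ρ := div_pos hε h₀
  rw [subQuad_univ_xStar_add_smul_gVec h₀ h₁]
  have : 0 < 2 * a * (ε / ρ) + (ε / ρ) ^ 2 := by positivity
  linarith [hC.2.2.2.2.1]

/-- An interval is an order-connected set, and here a rejected parameter lies between two accepted
ones. -/
theorem not_ordConnected_acceptSection {M : ℕ} {S : Matrix (Fin M) (Fin M) ℝ} (hS : S.PosDef)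
    {i : Fin M} {φ : EuclideanSpace ℝ (Fin M) → ℝ} {x g : EuclideanSpace ℝ (Fin M)} {s t : ℝ}
    (hg : g = WithLp.toLp 2 fun j => S j i) (hs : 0 ≤ s) (ht : 0 ≤ t)
    (h₁ : φ (x - s • g) = 0) (h₂ : φ x ≠ 0) (h₃ : φ (x + t • g) = 0) :
    ¬ (acceptSection S i φ (S⁻¹ *ᵥ x.ofLp)).OrdConnected := by
  intro h
  have hmem : ∀ c : ℝ, (S⁻¹ *ᵥ x.ofLp) i + c ∈ acceptSection S i φ (S⁻¹ *ᵥ x.ofLp)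
      ↔ φ (x + c • g) = 0 := by
    intro c
    rw [hg, ← mulVec_update_inv_mulVec hS]
    rfl
  have := h.out ((hmem (-s)).2 (by rwa [neg_smul, ← sub_eq_add_neg])) ((hmem t).2 h₃)
    (show (S⁻¹ *ᵥ x.ofLp) i + 0 ∈ _ from ⟨by linarith, by linarith⟩)
  rw [hmem, zero_smul, add_zero] at this
  exact h₂ this

theorem not_admissible_lrsdTest (ha : 0 < a) (hΔ : 0 < Δ) (hb : a + Δ < b) (hε : 0 < ε)
    (h₀ : 0 < ρ) (h₁ : ρ < 1) (hD : 0 < stageTwoGap a b Δ ε ρ)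
    (hC : CriticalChoice a b Δ ε ρ C) :
    ¬ Admissible (intraclass 4 ρ) 0 (lrsdTest (intraclass 4 ρ) C 0) := by
  have hS := posDef_intraclass 4 h₀.le h₁
  have e₁ := (eventually_lrsdTest_eq_zero hS (C := C) (i := 0) (by decide)
    (abs_xStar_sub_smul_gVec_lt ha hΔ hb hε h₀) (subQuad_erase_three_lt ha h₀ h₁ hC)
    ).eventually_nhds
  have e₃ := (eventually_lrsdTest_eq_zero hS (C := C) (i := 0) (by decide)
    (abs_xStar_add_smul_gVec_lt ha hΔ hb hε h₀ h₁ hD) (subQuad_erase_two_lt hD h₀ h₁ hC)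
    ).eventually_nhds
  have t₁ : Filter.Tendsto (fun c : ℝ => c • xStar a b Δ ε - a • gVec ρ) (nhdsWithin 1 (Set.Ioi 1))
      (nhds (xStar a b Δ ε - a • gVec ρ)) :=
    (Continuous.tendsto' (by fun_prop) 1 _ (by simp)).mono_left nhdsWithin_le_nhds
  have t₃ : Filter.Tendsto (fun c : ℝ => c • xStar a b Δ ε + (ε / ρ) • gVec ρ)
      (nhdsWithin 1 (Set.Ioi 1)) (nhds (xStar a b Δ ε + (ε / ρ) • gVec ρ)) :=
    (Continuous.tendsto' (by fun_prop) 1 _ (by simp)).mono_left nhdsWithin_le_nhds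
  -- Acceptance near the two outer points is an open condition, so it survives replacing `x*` by `c
  -- • x*` for some `c > 1` close to 1. That point then lies inside the open rejected gap.
  obtain ⟨c, ⟨hc₁, hc₃⟩, hc⟩ :=
    (((t₁.eventually e₁).and (t₃.eventually e₃)).and self_mem_nhdsWithin).exists
  rw [← toLp_intraclass_row] at hc₁ hc₃
  exact not_admissible_of_gap hS.posSemidef (by simp [intraclass]) ha (div_pos hε h₀) hc₁
    (eventually_lrsdTest_eq_one_smul_xStar ha hΔ hb hε h₀ h₁ hC hc 0) hc₃

end CriticalValues

/-! ### Assembly of the main theorem -/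

theorem mainTheorem5 :
    (∀ a b Δ ε ρ : ℝ, 0 < a → 0 < Δ → a + Δ < b → 0 < ε → 0 < ρ → ρ < 1 →
      -- the likelihood ratio statistic of every stage is the quadratic form
      (∀ (A : Finset (Fin 4)) (x : EuclideanSpace ℝ (Fin 4)), A.Nonempty →
        likelihoodRatioStat (subCov (intraclass 4 ρ) A) (subVec x A)
          = subQuad (intraclass 4 ρ) A x) ∧
      -- the second-stage statistic at `x*`, and its excess over the one at `x* + γ g`
      subQuad (intraclass 4 ρ) {0, 1, 2} (xStar a b Δ ε) = stageTwoStat a b Δ ρ ∧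
      subQuad (intraclass 4 ρ) {0, 1, 2} (xStar a b Δ ε)
          - subQuad (intraclass 4 ρ) {0, 1, 3} (xStar a b Δ ε + (ε / ρ) • gVec ρ)
        = stageTwoGap a b Δ ε ρ ∧
      (0 < stageTwoGap a b Δ ε ρ →
        (∃ C : Fin 4 → ℝ, CriticalChoice a b Δ ε ρ C) ∧
        ∀ C : Fin 4 → ℝ, CriticalChoice a b Δ ε ρ C →
          -- `x*`: all hypotheses are rejected, in particular the first
          (∀ i, LRSDRejects (intraclass 4 ρ) C (xStar a b Δ ε) i) ∧
          -- `x* + γ g`: the first stage rejects, and only the third hypothesis is rejected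
          C 0 < subQuad (intraclass 4 ρ) Finset.univ (xStar a b Δ ε + (ε / ρ) • gVec ρ) ∧
          (∀ i, LRSDRejects (intraclass 4 ρ) C (xStar a b Δ ε + (ε / ρ) • gVec ρ) i ↔ i = 2) ∧
          -- `x* - x*_1 g`: the first hypothesis is accepted
          ¬ LRSDRejects (intraclass 4 ρ) C (xStar a b Δ ε - a • gVec ρ) 0 ∧
          -- the acceptance section in `y_1` is not an interval
          ¬ (acceptSection (intraclass 4 ρ) 0 (lrsdTest (intraclass 4 ρ) C 0)
              ((intraclass 4 ρ)⁻¹ *ᵥ (xStar a b Δ ε).ofLp)).OrdConnected ∧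
          -- the test of the first hypothesis is a test, and it is inadmissible
          IsTest (lrsdTest (intraclass 4 ρ) C 0) ∧
          ¬ Admissible (intraclass 4 ρ) 0 (lrsdTest (intraclass 4 ρ) C 0))) ∧
    -- an example of parameters with a positive excess, and `γ = ε / ρ = 0.2`
    0 < stageTwoGap 2 4 1 0.1 0.5 ∧ (0.1 / 0.5 : ℝ) = 0.2 := by
  refine ⟨fun a b Δ ε ρ ha hΔ hb hε h₀ h₁ => ?_, by norm_num [stageTwoGap], by norm_num⟩
  have hS := posDef_intraclass 4 h₀.le h₁
  refine ⟨fun A x _ => likelihoodRatioStat_subVec hS A x, subQuad_xStar h₀ h₁,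
    subQuad_xStar_sub_subQuad h₀ h₁, fun hD =>
    ⟨exists_criticalChoice ha hΔ hb hε h₀ h₁, fun C hC => ?_⟩⟩
  have hrej := lrsdRejects_xStar ha hΔ hb hε h₀ h₁ hC
  have hfirst := lt_subQuad_univ_xStar_add_smul_gVec ha hε h₀ h₁ hC
  have hright : ∀ i, LRSDRejects (intraclass 4 ρ) C (xStar a b Δ ε + (ε / ρ) • gVec ρ) i ↔ i = 2 :=
    fun i => (lrsdRejects_iff_of_stage_two_lt hS (isLargest_of_lt (Finset.mem_univ 2) fun k _ hk =>
      abs_xStar_add_smul_gVec_lt ha hΔ hb hε h₀ h₁ hD k hk) (subQuad_erase_two_lt hD h₀ h₁ hC)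
      i).trans (and_iff_left hfirst.le)
  have hleft := (eventually_lrsdTest_eq_zero hS (C := C) (i := 0) (by decide)
    (abs_xStar_sub_smul_gVec_lt ha hΔ hb hε h₀) (subQuad_erase_three_lt ha h₀ h₁ hC)).self_of_nhds
  refine ⟨hrej, hfirst, hright, lrsdTest_eq_zero_iff.1 hleft,
    not_ordConnected_acceptSection hS (g := gVec ρ) rfl ha.le (div_pos hε h₀).le hleft ?_ ?_,
    isTest_lrsdTest hS C 0, not_admissible_lrsdTest ha hΔ hb hε h₀ h₁ hD hC⟩
  · rw [lrsdTest_eq_one_iff.2 (hrej 0)]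
    exact one_ne_zero
  · rw [lrsdTest_eq_zero_iff, hright]
    decide
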